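/- **Theorem 3.4 (lower bound for locally differentially private frequency estimation).** Fix $n,B\in\mathbb N$ with $B\ge 1$, and let $[B]=\{1,\dots,B\}$. A local-model protocol $P=(R,A)$ for frequency estimation consists of a local randomizer $R:[B]\to\mathcal Z$ (a randomized map into a finite set $\mathcal Z$) and a randomized analyzer $A:\mathcal Z^n\to[0,1]^B$; its output on a dataset $X=(x_1,\dots,x_n)\in[B]^n$ is $P(X)=A(R(x_1),\dots,R(x_n))$, where the users randomize independently. It is *$(\varepsilon_L,\delta_L)$-locally differentially private* if $\Pr[R(x)\in S]\le e^{\varepsilon_L}\Pr[R(y)\in S]+\delta_L$ for all $x,y\in[B]$ and all $S\subseteq\mathcal Z$. It is *$(\alpha,\beta)$-accurate* if for every $X\in[B]^n$, $$\Pr\Big[\max_{j\in[B]}\Big|P(X)_j-\tfrac1n|\{i:x_i=j\}|\Big|\le\alpha\Big]\ge 1-\beta .$$ There are absolute constants $c>0$, $C>0$ and $k\in\mathbb N$ such that the following holds. Let $L=(1+\ln n+\ln B)^k$. Suppose $n\ge 1/c$, $\varepsilon_L>0$ and $0<\delta_L<c\cdot\min\{1/(n\log_2 n),\,e^{-\varepsilon_L}\}$.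 Then every $(\varepsilon_L,\delta_L)$-locally differentially private protocol that is $(\alpha,1/4)$-accurate satisfies all of the following. 1. If $n\ge \frac{\ln B}{c\,\varepsilon_L}$ and $\varepsilon_L\le\ln B$, then $\alpha\ge C\cdot\frac{\ln B}{n\varepsilon_L}$. 2. If $n\ge(\ln B)\,e^{\varepsilon_L/2}$ and $\frac23\ln n\le\varepsilon_L+\ln(1+\varepsilon_L)+\frac1c\le 2\ln B$, then $\alpha\ge \frac{C}{L}\cdot\frac{1}{\sqrt n\,e^{\varepsilon_L/4}}$. 3. If $(\ln B)^{3/2}\le n\le B^3$ and $\varepsilon_L\le\frac23\ln n$, then $\alpha\ge\frac{C}{L}\cdot n^{-2/3}$. 4. If $n\ge B^2$ and $\varepsilon_L\le 2\ln B$, then $\alpha\ge\frac{C}{L}\cdot\frac{\sqrt B}{n}$. 5. If $n\ge B^3$ and $\varepsilon_L\le 2\ln B$, then $\alpha\ge\frac{C}{L}\cdot\frac{B}{n}$. -/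

import Mathlib

open MeasureTheory

/-- A local randomizer `R : [B] → Z` is `(ε, δ)`-locally differentially private:
`P[R(x) ∈ S] ≤ e^ε P[R(y) ∈ S] + δ` for all inputs `x`, `y` and all sets `S` of messages
(any two one-user datasets are neighbouring). -/
def IsLocallyDP {B : ℕ} {Z : Type*} (R : Fin B → PMF Z) (ε δ : ℝ) : Prop :=
  ∀ x y : Fin B, ∀ S : Set Z,
    (R x).toOuterMeasure S ≤
      ENNReal.ofReal (Real.exp ε) * (R y).toOuterMeasure S + ENNReal.ofReal δ

/-- The law of the output `A(R(x₁), …, R(xₙ))` of the local-model protocol `(R, A)` on the dataset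
`x`. The `n` users randomize independently, each with `R`; the analyzer `A` is itself randomized:
it maps the received messages to a probability distribution on `[0,1]^B`. -/
noncomputable def outputLaw {n B : ℕ} {Z : Type*} [Fintype Z] (R : Fin B → PMF Z)
    (A : (Fin n → Z) → ProbabilityMeasure (Fin B → unitInterval)) (x : Fin n → Fin B) :
    Measure (Fin B → unitInterval) :=
  ∑ z : Fin n → Z, (∏ i, R (x i) (z i)) • (A z : Measure (Fin B → unitInterval))

/-- The frequency of `j` in the dataset `x`. -/
noncomputable def frequency {n B : ℕ} (x : Fin n → Fin B) (j : Fin B) : ℝ :=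
  (Finset.univ.filter fun i => x i = j).card / (n : ℝ)

/-- `(α, β)`-accuracy for frequency estimation: on every dataset, with probability at least `1 - β`
all estimated frequencies are within `α` of the true ones. -/
def IsAccurate {n B : ℕ} {Z : Type*} [Fintype Z] (R : Fin B → PMF Z)
    (A : (Fin n → Z) → ProbabilityMeasure (Fin B → unitInterval)) (α β : ℝ) : Prop :=
  ∀ x : Fin n → Fin B,
    ENNReal.ofReal (1 - β) ≤
      outputLaw R A x {y | ∀ j, |(y j : ℝ) - frequency x j| ≤ α}

/-- The polylogarithmic factor `(1 + ln n + ln B)^k` that is suppressed by `Ω̃`. -/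
noncomputable def polylog (k n B : ℕ) : ℝ :=
  (1 + Real.log n + Real.log B) ^ k

/-! Regime 1 is a packing argument. Let `m ≈ ln B / ε` users all hold the same value `j`: the `B`
resulting datasets have disjoint sets of accurate answers once `α < m / (2n)`, while group privacy
gives each of these sets mass at least of order `1/B` under one fixed dataset
(`IsAccurate.div_le_of_isLocallyDP`).

The other regimes are Bayesian. Draw the inputs independently from a prior `π`. Given the messages
they remain independent, so the number of users holding `j` is a sum of independent Bernoulli
variables. If the mean posterior variance per user is `v`, this count spreads over about `√(n v)`
integers, whereas one estimate is within `α` of at most `2nα + 1` possible counts; hence `α` is at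
least of order `√(v / n)` (`IsAccurate.one_sub_le_mul_sqrt`).

It remains to find a prior with `v` of order `1/D` when `e^ε ≤ 4D²`
(`IsAccurate.one_div_sqrt_le_of_isLocallyDP`). Take `D` values besides a reference value. If
messages often fail to identify a uniform value of the block, the uniform prior works. If they
identify it well, privacy forces the reference value to produce the same messages with probability
at least of order `1/D`, and a prior mixing the reference with a thin layer of the block works. Each
regime is then a choice of `D`. -/

/-! ### Anti-concentration of a count by Fourier inversion -/

section Fourier

/-- The transform `b ↦ ∑ b, q b e^{i t [b = j]}` of the indicator of `j` under the weights `q`. -/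
noncomputable def atomTransform {ι : Type*} [Fintype ι] [DecidableEq ι] (q : ι → ℝ) (j : ι)
    (t : ℝ) : ℂ :=
  ∑ b, (q b : ℂ) * (if b = j then Complex.exp (t * Complex.I) else 1)

variable {ι : Type*} [Fintype ι] [DecidableEq ι]

theorem continuous_atomTransform (q : ι → ℝ) (j : ι) : Continuous (atomTransform q j) := by
  unfold atomTransform
  refine continuous_finsetSum _ fun b _ => ?_
  split_ifs <;> fun_prop

theorem atomTransform_eq (q : ι → ℝ) (j : ι) (t : ℝ) :
    atomTransform q j t
      = ((∑ b, q b - q j : ℝ) : ℂ) + (q j : ℂ) * Complex.exp (t * Complex.I) := by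
  unfold atomTransform
  have h : ∀ b, (q b : ℂ) * (if b = j then Complex.exp (t * Complex.I) else 1)
      = (q b : ℂ) + (if b = j then (q b : ℂ) * (Complex.exp (t * Complex.I) - 1) else 0) := by
    intro b; split_ifs <;> ring
  simp only [h, Finset.sum_add_distrib, Finset.sum_ite_eq', Finset.mem_univ, if_true]
  push_cast
  ring

/-- The squared modulus is exactly `m² - 2u(m - u)(1 - cos t)`, with `m` the total weight and `u = q
j`; the bound is then `√(1 - 2s) ≤ 1 - s`. The coefficient `u(m - u)/m` is `m` times the variance of
a Bernoulli variable of parameter `u/m`. -/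
theorem norm_atomTransform_le (q : ι → ℝ) (hq : ∀ b, 0 ≤ q b) (j : ι) (t : ℝ) :
    ‖atomTransform q j t‖ ≤
      ∑ b, q b - q j * (∑ b, q b - q j) / (∑ b, q b) * (1 - Real.cos t) := by
  rw [atomTransform_eq]
  set m := ∑ b, q b with hm
  set u := q j with hu
  have hu0 : 0 ≤ u := hq j
  have hum : u ≤ m := Finset.single_le_sum (fun b _ => hq b) (Finset.mem_univ j)
  rcases (hu0.trans hum).eq_or_lt with h0 | hpos
  · have : u = 0 := le_antisymm (h0 ▸ hum) hu0
    simp [this, ← h0]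
  have hc1 := Real.cos_le_one t
  have hc2 := Real.neg_one_le_cos t
  have hsq : ‖((m - u : ℝ) : ℂ) + (u : ℂ) * Complex.exp (t * Complex.I)‖ ^ 2
      = m ^ 2 - 2 * (u * (m - u)) * (1 - Real.cos t) := by
    rw [← Complex.normSq_eq_norm_sq, Complex.normSq_apply]
    simp only [Complex.add_re, Complex.add_im, Complex.ofReal_re, Complex.ofReal_im,
      Complex.re_ofReal_mul, Complex.im_ofReal_mul, Complex.exp_ofReal_mul_I_re,
      Complex.exp_ofReal_mul_I_im]
    linear_combination u ^ 2 * Real.sin_sq_add_cos_sq t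
  have hr : m ^ 2 - 2 * (u * (m - u)) * (1 - Real.cos t)
      ≤ (m - u * (m - u) / m * (1 - Real.cos t)) ^ 2 := by
    have : u * (m - u) / m * m = u * (m - u) := by field_simp
    nlinarith [sq_nonneg (u * (m - u) / m * (1 - Real.cos t))]
  have hnn : 0 ≤ m - u * (m - u) / m * (1 - Real.cos t) := by
    have h1 : u * (m - u) / m ≤ m / 2 := by
      rw [div_le_iff₀ hpos]; nlinarith [sq_nonneg (m - 2 * u), sq_nonneg m]
    have h2 : 0 ≤ u * (m - u) / m := by have := sub_nonneg.2 hum; positivity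
    nlinarith
  exact abs_le_of_sq_le_sq' (hsq.trans_le hr) hnn |>.2

theorem integral_exp_pow_mul_exp_neg_pow (a b : ℕ) :
    ∫ t in (-Real.pi)..Real.pi,
        Complex.exp (t * Complex.I) ^ b * Complex.exp (-(t * Complex.I)) ^ a
      = if b = a then 2 * (Real.pi : ℂ) else 0 := by
  split_ifs with h
  · subst h
    simp only [← mul_pow, ← Complex.exp_add, add_neg_cancel, Complex.exp_zero, one_pow]
    simp
    ring
  · set k : ℤ := (b : ℤ) - a with hk
    have hk0 : (k : ℂ) * Complex.I ≠ 0 := by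
      have : k ≠ 0 := by omega
      simp [this]
    have he : ∀ t : ℝ, Complex.exp (t * Complex.I) ^ b * Complex.exp (-(t * Complex.I)) ^ a
        = Complex.exp (((k : ℂ) * Complex.I) * t) := by
      intro t
      rw [← Complex.exp_nat_mul, ← Complex.exp_nat_mul, ← Complex.exp_add, hk]
      congr 1
      push_cast
      ring
    simp only [he]
    rw [integral_exp_mul_complex hk0]
    have : Complex.exp ((k : ℂ) * Complex.I * (Real.pi : ℝ))
        = Complex.exp ((k : ℂ) * Complex.I * ((-Real.pi : ℝ) : ℂ)) := by
      rw [Complex.exp_eq_exp_iff_exists_int]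
      refine ⟨k, ?_⟩
      push_cast
      ring
    rw [this, sub_self, zero_div]

/-- Concentration function bound: the probability that exactly `a` of `n` independent
(unnormalized) draws hit `j` is at most the mean modulus of the characteristic function. -/
theorem sum_count_eq_le_integral {n : ℕ} (q : Fin n → ι → ℝ) (j : ι) (a : ℕ) :
    ∑ x : Fin n → ι, (if (Finset.univ.filter fun i => x i = j).card = a
        then ∏ i, q i (x i) else 0)
      ≤ (2 * Real.pi)⁻¹ * ∫ t in (-Real.pi)..Real.pi, ∏ i, ‖atomTransform (q i) j t‖ := by
  -- The product is the generating function of the count; integrating against `e^{-ita}` extracts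
  -- its coefficient at `a`.
  have hexp : ∀ t : ℝ, (∏ i, atomTransform (q i) j t)
      = ∑ x : Fin n → ι, ((∏ i, q i (x i) : ℝ) : ℂ) *
        Complex.exp (t * Complex.I) ^ (Finset.univ.filter fun i => x i = j).card := by
    intro t
    unfold atomTransform
    rw [Finset.prod_univ_sum, Fintype.piFinset_univ]
    refine Finset.sum_congr rfl fun x _ => ?_
    rw [Finset.prod_mul_distrib, Finset.prod_ite, Finset.prod_const, Finset.prod_const_one, mul_one]
    push_cast
    rfl
  have hint : ∫ t in (-Real.pi)..Real.pi,
      (∏ i, atomTransform (q i) j t) * Complex.exp (-(t * Complex.I)) ^ a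
      = ((2 * Real.pi * ∑ x : Fin n → ι, (if (Finset.univ.filter fun i => x i = j).card = a
        then ∏ i, q i (x i) else 0) : ℝ) : ℂ) := by
    simp only [hexp, Finset.sum_mul, mul_assoc]
    rw [intervalIntegral.integral_finsetSum]
    · simp only [intervalIntegral.integral_const_mul, integral_exp_pow_mul_exp_neg_pow]
      push_cast
      simp only [Finset.mul_sum]
      refine Finset.sum_congr rfl fun x _ => ?_
      split_ifs <;> push_cast <;> ring
    · intro x _
      apply Continuous.intervalIntegrable
      fun_prop
  have hpi := Real.pi_pos
  have hnorm := intervalIntegral.norm_integral_le_integral_norm (μ := volume)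
    (f := fun t : ℝ => (∏ i, atomTransform (q i) j t) * Complex.exp (-(t * Complex.I)) ^ a)
    (show -Real.pi ≤ Real.pi by linarith)
  rw [hint, Complex.norm_real, Real.norm_eq_abs] at hnorm
  have h1 : ∀ t : ℝ, ‖(∏ i, atomTransform (q i) j t) * Complex.exp (-(t * Complex.I)) ^ a‖
      = ∏ i, ‖atomTransform (q i) j t‖ := by
    intro t
    have : -((t : ℂ) * Complex.I) = ((-t : ℝ) : ℂ) * Complex.I := by push_cast; ring
    rw [norm_mul, norm_pow, this, Complex.norm_exp_ofReal_mul_I, one_pow, mul_one, norm_prod]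
  simp only [h1] at hnorm
  rw [inv_mul_eq_div, le_div_iff₀ (by positivity), mul_comm]
  exact (le_abs_self _).trans hnorm

theorem integral_one_sub_mul_one_sub_cos_pow_le {n : ℕ} (hn : 0 < n) {v : ℝ} (hv : 0 < v)
    {f : ℝ → ℝ} (hf : Continuous f) (hf0 : ∀ t, 0 ≤ f t)
    (hfv : ∀ t, f t ≤ 1 - v * (1 - Real.cos t)) :
    (2 * Real.pi)⁻¹ * ∫ t in (-Real.pi)..Real.pi, f t ^ n
      ≤ Real.sqrt (Real.pi / (2 * n * v)) / 2 := by
  have hpi := Real.pi_pos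
  -- From `cos t ≤ 1 - 2t²/π²` on `[-π, π]`, so that `f t ^ n` lies below a Gaussian.
  set b : ℝ := 2 * n * v / Real.pi ^ 2 with hb
  have hb0 : 0 < b := by positivity
  have hle : ∫ t in (-Real.pi)..Real.pi, f t ^ n
      ≤ ∫ t in (-Real.pi)..Real.pi, Real.exp (-b * t ^ 2) := by
    refine intervalIntegral.integral_mono_on (by linarith)
      (by apply Continuous.intervalIntegrable; fun_prop)
      (by apply Continuous.intervalIntegrable; fun_prop) fun t ht => ?_
    have hc := Real.cos_le_one_sub_mul_cos_sq (x := t) (abs_le.2 ⟨ht.1, ht.2⟩)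
    have h1 : f t ≤ Real.exp (-(v * (2 / Real.pi ^ 2 * t ^ 2))) := by
      have h2 := Real.add_one_le_exp (-(v * (2 / Real.pi ^ 2 * t ^ 2)))
      have h3 := hfv t
      nlinarith
    calc f t ^ n ≤ Real.exp (-(v * (2 / Real.pi ^ 2 * t ^ 2))) ^ n :=
          pow_le_pow_left₀ (hf0 t) h1 n
      _ = Real.exp (-b * t ^ 2) := by
          rw [← Real.exp_nat_mul, hb]; congr 1; ring
  have hG : ∫ t in (-Real.pi)..Real.pi, Real.exp (-b * t ^ 2) ≤ Real.sqrt (Real.pi / b) := by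
    rw [← integral_gaussian, intervalIntegral.integral_of_le (by linarith)]
    exact setIntegral_le_integral (integrable_exp_neg_mul_sq hb0)
      (Filter.Eventually.of_forall fun t => (Real.exp_pos _).le)
  have hs : Real.sqrt (Real.pi / b) = Real.pi * Real.sqrt (Real.pi / (2 * n * v)) := by
    have : Real.pi / b = Real.pi ^ 2 * (Real.pi / (2 * n * v)) := by rw [hb]; field_simp
    rw [this, Real.sqrt_mul (by positivity), Real.sqrt_sq hpi.le]
  calc (2 * Real.pi)⁻¹ * ∫ t in (-Real.pi)..Real.pi, f t ^ n
      ≤ (2 * Real.pi)⁻¹ * (Real.pi * Real.sqrt (Real.pi / (2 * n * v))) := by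
        rw [← hs]; gcongr; exact hle.trans hG
    _ = _ := by field_simp

end Fourier

/-! ### From accuracy to the Bayesian bound -/

theorem PMF.sum_toReal_eq_one {Z : Type*} [Fintype Z] (p : PMF Z) : ∑ z, (p z).toReal = 1 := by
  rw [← ENNReal.toReal_sum fun z _ => p.apply_ne_top z, ← tsum_fintype (L := .unconditional _),
    p.tsum_coe, ENNReal.toReal_one]

theorem outputLaw_real {n B : ℕ} {Z : Type*} [Fintype Z] (R : Fin B → PMF Z)
    (A : (Fin n → Z) → ProbabilityMeasure (Fin B → unitInterval)) (x : Fin n → Fin B)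
    (S : Set (Fin B → unitInterval)) :
    (outputLaw R A x).real S
      = ∑ z : Fin n → Z, (∏ i, (R (x i) (z i)).toReal) * (A z : Measure _).real S := by
  unfold outputLaw
  rw [measureReal_def, Measure.finsetSum_apply, ENNReal.toReal_sum]
  · simp [measureReal_def, ENNReal.toReal_mul, ENNReal.toReal_prod]
  · intro z _
    rw [Measure.smul_apply, smul_eq_mul]
    exact ENNReal.mul_ne_top (ENNReal.prod_ne_top fun i _ => PMF.apply_ne_top _ _)
      (measure_ne_top _ _)

theorem IsAccurate.le_real {n B : ℕ} {Z : Type*} [Fintype Z] {R : Fin B → PMF Z}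
    {A : (Fin n → Z) → ProbabilityMeasure (Fin B → unitInterval)} {α β : ℝ}
    (h : IsAccurate R A α β) (x : Fin n → Fin B) {S : Set (Fin B → unitInterval)}
    (hS : {y : Fin B → unitInterval | ∀ j, |(y j : ℝ) - frequency x j| ≤ α} ⊆ S) :
    1 - β ≤ ∑ z : Fin n → Z, (∏ i, (R (x i) (z i)).toReal) * (A z : Measure _).real S := by
  have hfin : outputLaw R A x S ≠ ⊤ := by
    unfold outputLaw
    rw [Measure.finsetSum_apply]
    refine (ENNReal.sum_lt_top.2 fun z _ => ?_).ne
    rw [Measure.smul_apply, smul_eq_mul]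
    exact ENNReal.mul_lt_top (ENNReal.prod_lt_top fun i _ => (PMF.apply_ne_top _ _).lt_top)
      (measure_lt_top _ _)
  rw [← outputLaw_real, measureReal_def, ← ENNReal.ofReal_le_iff_le_toReal hfin]
  exact (h x).trans (measure_mono hS)

theorem IsAccurate.nonneg {n B : ℕ} {Z : Type*} [Fintype Z] {R : Fin B → PMF Z}
    {A : (Fin n → Z) → ProbabilityMeasure (Fin B → unitInterval)} {α β : ℝ}
    (h : IsAccurate R A α β) (hβ : β < 1) (j : Fin B) : 0 ≤ α := by
  by_contra! hα
  have := h.le_real (fun _ => j) (S := ∅) fun y hy => ((abs_nonneg _).trans (hy j)).not_gt hα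
  simp at this
  linarith

/-- Double counting: the sum of the measures is the expected number of sets containing the random
point. It is used both for overlapping windows around counts and, with `K = 1`, for disjoint sets.
-/
theorem sum_measureReal_le_of_card_le {Ω κ : Type*} [MeasurableSpace Ω] (μ : Measure Ω)
    [IsProbabilityMeasure μ] {F : κ → Set Ω} (hF : ∀ a, MeasurableSet (F a)) (s : Finset κ) {K : ℝ}
    (hK : ∀ ω, ∀ t ⊆ s, (∀ a ∈ t, ω ∈ F a) → (t.card : ℝ) ≤ K) :
    ∑ a ∈ s, μ.real (F a) ≤ K := by
  classical
  have h1 : ∑ a ∈ s, μ.real (F a) = ∫ ω, ∑ a ∈ s, (F a).indicator (1 : Ω → ℝ) ω ∂μ := by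
    rw [integral_finsetSum]
    · exact Finset.sum_congr rfl fun a _ => (integral_indicator_one (hF a)).symm
    · exact fun a _ => (integrable_const (1 : ℝ)).indicator (hF a)
  have h2 : ∫ ω, ∑ a ∈ s, (F a).indicator (1 : Ω → ℝ) ω ∂μ ≤ ∫ _, K ∂μ := by
    refine integral_mono (integrable_finsetSum _ fun a _ =>
      (integrable_const (1 : ℝ)).indicator (hF a)) (integrable_const _) fun ω => ?_
    refine le_of_eq_of_le ?_
      (hK ω (s.filter fun a => ω ∈ F a) (Finset.filter_subset _ _) (by simp))
    simp [Set.indicator_apply]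
  rw [h1]
  simpa using h2

theorem card_le_of_abs_sub_div_le {n : ℕ} (hn : 0 < n) {y α : ℝ} (hα : 0 ≤ α) (t : Finset ℕ)
    (ht : ∀ a ∈ t, |y - (a : ℝ) / n| ≤ α) : (t.card : ℝ) ≤ 2 * n * α + 1 := by
  have hn' : (0 : ℝ) < n := by exact_mod_cast hn
  have hsub : t.image (fun a : ℕ => (a : ℤ)) ⊆ Finset.Icc ⌈n * y - n * α⌉ ⌊n * y + n * α⌋ := by
    intro b hb
    obtain ⟨a, ha, rfl⟩ := Finset.mem_image.1 hb
    have h := abs_le.1 (ht a ha)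
    have he : (n : ℝ) * (a / n) = a := by field_simp
    rw [Finset.mem_Icc, Int.ceil_le, Int.le_floor]
    push_cast
    constructor <;> nlinarith
  have hc := Finset.card_le_card hsub
  rw [Finset.card_image_of_injective _ Nat.cast_injective, Int.card_Icc] at hc
  have h1 := Int.floor_le ((n : ℝ) * y + n * α)
  have h2 := Int.le_ceil ((n : ℝ) * y - n * α)
  rcases le_total 0 (⌊(n : ℝ) * y + n * α⌋ + 1 - ⌈(n : ℝ) * y - n * α⌉) with h | h
  · have : (t.card : ℤ) ≤ ⌊(n : ℝ) * y + n * α⌋ + 1 - ⌈(n : ℝ) * y - n * α⌉ := by omega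
    have : (t.card : ℝ) ≤ (⌊(n : ℝ) * y + n * α⌋ + 1 - ⌈(n : ℝ) * y - n * α⌉ : ℤ) := by
      exact_mod_cast this
    push_cast at this
    linarith
  · have : t.card = 0 := by omega
    rw [this]
    push_cast
    positivity

theorem sum_pi_prod {n : ℕ} {Z : Type*} [Fintype Z] (f : Fin n → Z → ℝ) :
    ∑ z : Fin n → Z, ∏ i, f i (z i) = ∏ i, ∑ z, f i z := by
  rw [Finset.prod_univ_sum, Fintype.piFinset_univ]

/-- Bayesian lower bound on the accuracy: when the inputs are drawn independently from `π`, the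
posterior variance of the number of inputs equal to `j` is on average `n` times the sum below, and
the estimate of that number cannot be much better than the posterior standard deviation. -/
theorem IsAccurate.one_sub_le_mul_sqrt {n B : ℕ} {Z : Type*} [Fintype Z] {R : Fin B → PMF Z}
    {A : (Fin n → Z) → ProbabilityMeasure (Fin B → unitInterval)} {α β : ℝ}
    (h : IsAccurate R A α β) (hα : 0 ≤ α) (hn : 0 < n) (π : Fin B → ℝ) (hπ : ∀ b, 0 ≤ π b)
    (hπ1 : ∑ b, π b = 1) (j : Fin B) {v : ℝ} (hv : 0 < v)
    (hvle : v ≤ ∑ z, π j * (R j z).toReal *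
      (∑ b, π b * (R b z).toReal - π j * (R j z).toReal) / ∑ b, π b * (R b z).toReal) :
    1 - β ≤ (2 * n * α + 1) * (Real.sqrt (Real.pi / (2 * n * v)) / 2) := by
  set q : Z → Fin B → ℝ := fun z b => π b * (R b z).toReal with hq
  have hq0 : ∀ z b, 0 ≤ q z b := fun z b => mul_nonneg (hπ b) ENNReal.toReal_nonneg
  let cnt : (Fin n → Fin B) → ℕ := fun x => (Finset.univ.filter fun i => x i = j).card
  let F : ℕ → Set (Fin B → unitInterval) := fun a => {y | |(y j : ℝ) - (a : ℝ) / n| ≤ α}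
  have hF : ∀ a, MeasurableSet (F a) := fun a =>
    (isClosed_le (by fun_prop) continuous_const).measurableSet
  -- Bounds every atom of the unnormalized posterior law of the count, uniformly in the value of the
  -- count.
  let M : (Fin n → Z) → ℝ := fun z =>
    (2 * Real.pi)⁻¹ * ∫ t in (-Real.pi)..Real.pi, ∏ i, ‖atomTransform (q (z i)) j t‖
  have hM0 : ∀ z, 0 ≤ M z := fun z => by
    have hpi := Real.pi_pos
    refine mul_nonneg (by positivity) (intervalIntegral.integral_nonneg (by linarith) fun t _ => ?_)
    positivity
  have hx : ∀ x : Fin n → Fin B, (1 - β) * ∏ i, π (x i)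
      ≤ ∑ z : Fin n → Z, (∏ i, q (z i) (x i)) * (A z : Measure _).real (F (cnt x)) := by
    intro x
    have h1 := h.le_real x (S := F (cnt x)) fun y hy => hy j
    have h2 := mul_le_mul_of_nonneg_right h1 
      (Finset.prod_nonneg (s := Finset.univ) fun i _ => hπ (x i))
    refine h2.trans_eq ?_
    rw [Finset.sum_mul]
    refine Finset.sum_congr rfl fun z _ => ?_
    simp only [hq, Finset.prod_mul_distrib]
    ring
  have hcnt : ∀ x : Fin n → Fin B, cnt x ∈ Finset.range (n + 1) := fun x => by
    have := Finset.card_filter_le (Finset.univ : Finset (Fin n)) fun i => x i = j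
    rw [Finset.card_univ, Fintype.card_fin] at this
    exact Finset.mem_range.2 (Nat.lt_succ_of_le this)
  have hz : ∀ z : Fin n → Z,
      ∑ x : Fin n → Fin B, (∏ i, q (z i) (x i)) * (A z : Measure _).real (F (cnt x))
        ≤ (2 * n * α + 1) * M z := by
    intro z
    have h1 : ∀ x : Fin n → Fin B, (∏ i, q (z i) (x i)) * (A z : Measure _).real (F (cnt x))
        = ∑ a ∈ Finset.range (n + 1), (if cnt x = a then ∏ i, q (z i) (x i) else 0) *
          (A z : Measure _).real (F a) := by
      intro x
      rw [Finset.sum_eq_single_of_mem (cnt x) (hcnt x)]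
      · rw [if_pos rfl]
      · intro a _ ha
        rw [if_neg ha.symm, zero_mul]
    simp only [h1]
    rw [Finset.sum_comm]
    simp only [← Finset.sum_mul]
    calc _ ≤ ∑ a ∈ Finset.range (n + 1), M z * (A z : Measure _).real (F a) := by
          refine Finset.sum_le_sum fun a _ => mul_le_mul_of_nonneg_right ?_ measureReal_nonneg
          exact sum_count_eq_le_integral (fun i => q (z i)) j a
      _ = M z * ∑ a ∈ Finset.range (n + 1), (A z : Measure _).real (F a) := by
          rw [Finset.mul_sum]
      _ ≤ M z * (2 * n * α + 1) := by
          refine mul_le_mul_of_nonneg_left ?_ (hM0 z)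
          exact sum_measureReal_le_of_card_le _ hF _ fun y t _ ht =>
            card_le_of_abs_sub_div_le hn hα t ht
      _ = _ := mul_comm _ _
  have hsum : 1 - β ≤ (2 * n * α + 1) * ∑ z, M z := by
    calc 1 - β = ∑ x : Fin n → Fin B, (1 - β) * ∏ i, π (x i) := by
          rw [← Finset.mul_sum, sum_pi_prod fun _ => π]
          simp [hπ1]
      _ ≤ ∑ x : Fin n → Fin B, ∑ z : Fin n → Z,
            (∏ i, q (z i) (x i)) * (A z : Measure _).real (F (cnt x)) :=
          Finset.sum_le_sum fun x _ => hx x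
      _ = ∑ z : Fin n → Z, ∑ x : Fin n → Fin B,
            (∏ i, q (z i) (x i)) * (A z : Measure _).real (F (cnt x)) := Finset.sum_comm
      _ ≤ ∑ z, (2 * n * α + 1) * M z := Finset.sum_le_sum fun z _ => hz z
      _ = _ := by rw [Finset.mul_sum]
  have hcont : ∀ z, Continuous fun t => ‖atomTransform (q z) j t‖ := fun z =>
    (continuous_atomTransform _ _).norm
  -- Summing over message vectors before integrating factorizes the integrand into an `n`-th power,
  -- so only the mean of the posterior variance matters and no concentration over the messages is
  -- needed.
  have hMsum : ∑ z, M z = (2 * Real.pi)⁻¹ *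
      ∫ t in (-Real.pi)..Real.pi, (∑ z, ‖atomTransform (q z) j t‖) ^ n := by
    simp only [M]
    rw [← Finset.mul_sum, ← intervalIntegral.integral_finsetSum]
    · congr 2
      ext t
      rw [sum_pi_prod fun (_ : Fin n) z => ‖atomTransform (q z) j t‖]
      simp
    · intro z _
      exact (continuous_finsetProd _ fun i _ => hcont (z i)).intervalIntegrable _ _
  have hm : ∑ z, ∑ b, q z b = 1 := by
    rw [Finset.sum_comm]
    simp only [hq, ← Finset.mul_sum, PMF.sum_toReal_eq_one, mul_one, hπ1]
  refine hsum.trans (mul_le_mul_of_nonneg_left ?_ (by positivity))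
  rw [hMsum]
  refine integral_one_sub_mul_one_sub_cos_pow_le hn hv (continuous_finsetSum _ fun z _ => hcont z)
    (fun t => Finset.sum_nonneg fun z _ => norm_nonneg _) fun t => ?_
  calc ∑ z, ‖atomTransform (q z) j t‖
      ≤ ∑ z, (∑ b, q z b - q z j * (∑ b, q z b - q z j) / (∑ b, q z b) * (1 - Real.cos t)) :=
        Finset.sum_le_sum fun z _ => norm_atomTransform_le (q z) (hq0 z) j t
    _ = 1 - (∑ z, q z j * (∑ b, q z b - q z j) / ∑ b, q z b) * (1 - Real.cos t) := by
        rw [Finset.sum_sub_distrib, hm, Finset.sum_mul]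
    _ ≤ 1 - v * (1 - Real.cos t) := by
        have := Real.cos_le_one t
        gcongr

/-! ### Privacy forces posterior variance -/

/-- The sum is the privacy excess on the worst event, the set `S` where the difference is
nonnegative. -/
theorem IsLocallyDP.sum_max_sub_le {B : ℕ} {Z : Type*} [Fintype Z] {R : Fin B → PMF Z} {ε δ : ℝ}
    (h : IsLocallyDP R ε δ) (hδ : 0 ≤ δ) (x y : Fin B) :
    ∑ z, max ((R x z).toReal - Real.exp ε * (R y z).toReal) 0 ≤ δ := by
  classical
  set S : Set Z := {z | 0 ≤ (R x z).toReal - Real.exp ε * (R y z).toReal} with hS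
  have hsum : ∀ w, ((R w).toOuterMeasure S).toReal = ∑ z,
      S.indicator (fun z => (R w z).toReal) z := by
    intro w
    rw [PMF.toOuterMeasure_apply_fintype, ENNReal.toReal_sum]
    · refine Finset.sum_congr rfl fun z _ => ?_
      by_cases hz : z ∈ S <;> simp [hz]
    · intro z _
      by_cases hz : z ∈ S <;> simp [hz, PMF.apply_ne_top]
  have hfin : ∀ w, (R w).toOuterMeasure S ≠ ⊤ := fun w => by
    rw [PMF.toOuterMeasure_apply_fintype]
    refine ENNReal.sum_ne_top.2 fun z _ => ?_
    by_cases hz : z ∈ S <;> simp [hz, PMF.apply_ne_top]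
  have h1 := ENNReal.toReal_mono (ENNReal.add_ne_top.2
    ⟨ENNReal.mul_ne_top ENNReal.ofReal_ne_top (hfin y), ENNReal.ofReal_ne_top⟩) (h x y S)
  rw [ENNReal.toReal_add (ENNReal.mul_ne_top ENNReal.ofReal_ne_top (hfin y)) ENNReal.ofReal_ne_top,
    ENNReal.toReal_mul, ENNReal.toReal_ofReal (Real.exp_pos _).le, ENNReal.toReal_ofReal hδ,
    hsum, hsum] at h1
  have h2 : ∑ z, max ((R x z).toReal - Real.exp ε * (R y z).toReal) 0
      = ∑ z, S.indicator (fun z => (R x z).toReal) z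
        - Real.exp ε * ∑ z, S.indicator (fun z => (R y z).toReal) z := by
    rw [Finset.mul_sum, ← Finset.sum_sub_distrib]
    refine Finset.sum_congr rfl fun z _ => ?_
    by_cases hz : z ∈ S
    · simp only [Set.indicator_of_mem hz]
      exact max_eq_left hz
    · simp only [Set.indicator_of_notMem hz, mul_zero, sub_zero]
      exact max_eq_right (not_le.1 hz).le
  linarith

theorem div_two_le_mul_div_add {t u r : ℝ} (hu : 0 ≤ u) (hr : 0 ≤ r) (htu : t ≤ u) (htr : t ≤ r) :
    t / 2 ≤ u * r / (u + r) := by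
  rcases le_or_gt t 0 with ht | ht
  · exact (by linarith : t / 2 ≤ 0).trans (by positivity)
  · rw [le_div_iff₀ (by linarith)]
    nlinarith [mul_le_mul_of_nonneg_left htu hr, mul_le_mul_of_nonneg_left htr hu]

/-- The weight of the elements of `J` other than the one drawn is at least the weight left by the
largest one. -/
theorem sub_le_sum_mul_sub_div {ι : Type*} (J : Finset ι) {w : ι → ℝ} (hw : ∀ j ∈ J, 0 ≤ w j)
    {M : ℝ} (hM0 : 0 ≤ M) (hM : ∀ j ∈ J, w j ≤ M) :
    ∑ j ∈ J, w j - M ≤ ∑ j ∈ J, w j * (∑ b ∈ J, w b - w j) / ∑ b ∈ J, w b := by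
  set q := ∑ j ∈ J, w j with hq
  rcases (Finset.sum_nonneg hw).eq_or_lt with h0 | hpos
  · rw [← hq] at h0
    simp [← h0, hM0]
  · rw [← hq] at hpos
    rw [← Finset.sum_div, le_div_iff₀ hpos]
    have h1 : (q - M) * q = ∑ j ∈ J, w j * (q - M) := by rw [← Finset.sum_mul, mul_comm]
    rw [h1]
    refine Finset.sum_le_sum fun j hj => mul_le_mul_of_nonneg_left ?_ (hw j hj)
    linarith [hM j hj]

/-- The condition `n ≥ 256 D` makes `s = √(D/n)` at most `1/16`, so the rounding term `+ 1` in `2nα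
+ 1` contributes at most `11/32 < 3/4` and the rest must come from `α`. -/
theorem IsAccurate.one_div_sqrt_le {n B : ℕ} {Z : Type*} [Fintype Z] {R : Fin B → PMF Z}
    {A : (Fin n → Z) → ProbabilityMeasure (Fin B → unitInterval)} {α : ℝ}
    (h : IsAccurate R A α (1 / 4)) {D : ℕ} (hD : 1 ≤ D) (hn : 256 * D ≤ n)
    (π : Fin B → ℝ) (hπ : ∀ b, 0 ≤ π b) (hπ1 : ∑ b, π b = 1) (j : Fin B)
    (hv : 1 / (64 * (D : ℝ)) ≤ ∑ z, π j * (R j z).toReal *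
      (∑ b, π b * (R b z).toReal - π j * (R j z).toReal) / ∑ b, π b * (R b z).toReal) :
    1 / (32 * Real.sqrt (n * D)) ≤ α := by
  have hα := h.nonneg (by norm_num) j
  have hD' : (1 : ℝ) ≤ D := by exact_mod_cast hD
  have hn' : (256 : ℝ) * D ≤ n := by exact_mod_cast hn
  have hn0 : (0 : ℝ) < n := by linarith
  have hB := h.one_sub_le_mul_sqrt hα (by omega) π hπ hπ1 j (by positivity) hv
  set s := Real.sqrt (D / n) with hs
  have hs0 : 0 < s := by positivity
  have hs1 : s ≤ 1 / 16 := by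
    rw [hs, Real.sqrt_le_left (by norm_num), div_le_iff₀ hn0]
    linarith
  have h1 : Real.sqrt (Real.pi / (2 * n * (1 / (64 * (D : ℝ))))) ≤ 11 * s := by
    rw [Real.sqrt_le_left (by positivity), mul_pow, hs, Real.sq_sqrt (by positivity)]
    have : Real.pi / (2 * n * (1 / (64 * (D : ℝ)))) = 32 * Real.pi * (D / n) := by
      field_simp; norm_num
    rw [this]
    have := Real.pi_lt_d2
    gcongr
    linarith
  have h2 : (3 / 4 : ℝ) ≤ (2 * n * α + 1) * (11 * s / 2) := by
    refine (by linarith : (3 / 4 : ℝ) ≤ _).trans (hB.trans ?_)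
    gcongr
  have h3 : n * s = Real.sqrt (n * D) := by
    have : (n : ℝ) * D = n ^ 2 * (D / n) := by field_simp
    rw [this, Real.sqrt_mul (by positivity), Real.sqrt_sq hn0.le]
  rw [div_le_iff₀ (by positivity), ← h3]
  nlinarith

/-- Frequency estimation over a block of `D` values besides a reference value is as hard as
sampling error at scale `√(n / D)`: either the messages of the block overlap, or a single reference
user is mistaken for a user of the block often enough. -/
theorem IsAccurate.one_div_sqrt_le_of_isLocallyDP {n B : ℕ} {Z : Type*} [Fintype Z]
    {R : Fin B → PMF Z} {A : (Fin n → Z) → ProbabilityMeasure (Fin B → unitInterval)}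
    {α ε δ : ℝ} (h : IsAccurate R A α (1 / 4)) (hR : IsLocallyDP R ε δ) {D : ℕ} (hD : 1 ≤ D)
    (hDB : D + 1 ≤ B) (hn : 256 * D ≤ n) (hε : Real.exp ε ≤ 4 * (D : ℝ) ^ 2) (hδ0 : 0 ≤ δ)
    (hδ : δ ≤ 1 / 4) :
    1 / (32 * Real.sqrt (n * D)) ≤ α := by
  have hD' : (1 : ℝ) ≤ D := by exact_mod_cast hD
  set x₀ : Fin B := ⟨0, by omega⟩
  obtain ⟨J, hJsub, hJ⟩ := Finset.exists_subset_card_eq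
    (s := (Finset.univ : Finset (Fin B)).erase x₀) (n := D) (by
      rw [Finset.card_erase_of_mem (Finset.mem_univ _), Finset.card_univ, Fintype.card_fin]; omega)
  have hx₀ : x₀ ∉ J := fun hx => Finset.notMem_erase x₀ _ (hJsub hx)
  have hJne : J.Nonempty := Finset.card_pos.1 (by omega)
  set p : Fin B → Z → ℝ := fun b z => (R b z).toReal with hp
  have hp0 : ∀ b z, 0 ≤ p b z := fun b z => ENNReal.toReal_nonneg
  have hp1 : ∀ b, ∑ z, p b z = 1 := fun b => PMF.sum_toReal_eq_one _
  let M : Z → ℝ := fun z => J.sup' hJne fun b => p b z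
  have hM : ∀ z, ∀ b ∈ J, p b z ≤ M z := fun z b hb =>
    Finset.le_sup' (fun b => p b z) hb
  have hM0 : ∀ z, 0 ≤ M z := fun z => (hp0 _ z).trans (hM z _ hJne.choose_spec)
  -- `(∑ z, M z) / D` is the best probability of guessing a uniform element of `J` from its message;
  -- the cases split at `1/2`.
  rcases le_or_gt (∑ z, M z) (D / 2) with hcase | hcase
  · have hsum : ∀ f : Fin B → ℝ, ∑ b, (if b ∈ J then 1 / (D : ℝ) else 0) * f b
        = ∑ b ∈ J, 1 / (D : ℝ) * f b := by
      intro f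
      simp only [ite_mul, zero_mul, Finset.sum_ite_mem, Finset.univ_inter]
    have hone : ∑ z, ∑ b ∈ J, 1 / (D : ℝ) * p b z = 1 := by
      rw [Finset.sum_comm]
      simp only [← Finset.mul_sum, hp1, Finset.sum_const, hJ, nsmul_eq_mul, mul_one]
      field_simp
    have htot : 1 / 2 ≤ ∑ j ∈ J, ∑ z, 1 / (D : ℝ) * p j z *
        (∑ b ∈ J, 1 / (D : ℝ) * p b z - 1 / (D : ℝ) * p j z) / ∑ b ∈ J, 1 / (D : ℝ) * p b z := by
      rw [Finset.sum_comm]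
      calc (1 / 2 : ℝ) ≤ ∑ z, (∑ b ∈ J, 1 / (D : ℝ) * p b z - 1 / (D : ℝ) * M z) := by
            rw [Finset.sum_sub_distrib, hone, ← Finset.mul_sum]
            have : 1 / (D : ℝ) * ∑ z, M z ≤ 1 / (D : ℝ) * (D / 2) := by gcongr
            have h2 : 1 / (D : ℝ) * (D / 2) = 1 / 2 := by field_simp
            linarith
        _ ≤ _ := by
            refine Finset.sum_le_sum fun z _ => sub_le_sum_mul_sub_div J ?_ ?_ ?_
            · intro j _; have := hp0 j z; positivity
            · have := hM0 z; positivity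
            · intro j hj; have := hM z j hj; gcongr
    -- The variances sum to at least `1/2` over the `D` elements, so some `j` has its share.
    obtain ⟨j, hj, hvj⟩ := Finset.exists_le_of_sum_le hJne
      (show ∑ _j ∈ J, 1 / (2 * (D : ℝ)) ≤ _ by
        refine le_trans (le_of_eq ?_) htot
        rw [Finset.sum_const, hJ, nsmul_eq_mul]; field_simp)
    refine h.one_div_sqrt_le hD hn (fun b => if b ∈ J then 1 / (D : ℝ) else 0) ?_ ?_ j ?_
    · intro b; split_ifs <;> positivity
    · have := hsum fun _ => 1
      simp only [mul_one] at this
      rw [this, Finset.sum_const, hJ, nsmul_eq_mul]; field_simp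
    · simp only [hsum, if_pos hj]
      refine le_trans ?_ hvj
      gcongr
      norm_num
  -- The block has total weight `1/(2D)`, and the count studied is that of `x₀`. By privacy and `e^ε
  -- ≤ 4D²`, the weights of `x₀` and of the block at `z` are both at least `M z / (8D²)`, up to the
  -- excess.
  · set π : Fin B → ℝ := fun b =>
      (if b = x₀ then 1 - 1 / (2 * (D : ℝ)) else 0)
        + (if b ∈ J then 1 / (2 * (D : ℝ) ^ 2) else 0) with hπ
    have hη : 1 / (2 * (D : ℝ)) ≤ 1 / 2 := by
      rw [div_le_div_iff₀ (by positivity) (by norm_num)]; linarith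
    have hsum : ∀ f : Fin B → ℝ, ∑ b, π b * f b
        = (1 - 1 / (2 * (D : ℝ))) * f x₀ + ∑ b ∈ J, 1 / (2 * (D : ℝ) ^ 2) * f b := by
      intro f
      simp only [hπ, add_mul, Finset.sum_add_distrib, ite_mul, zero_mul, Finset.sum_ite_mem,
        Finset.univ_inter, Finset.sum_ite_eq', Finset.mem_univ, if_true]
    have hπx₀ : π x₀ = 1 - 1 / (2 * (D : ℝ)) := by simp [hπ, hx₀]
    refine h.one_div_sqrt_le hD hn π ?_ ?_ x₀ ?_
    · intro b
      refine add_nonneg ?_ ?_ <;> split_ifs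
      · linarith
      · exact le_rfl
      · positivity
      · exact le_rfl
    · have := hsum fun _ => 1
      simp only [mul_one] at this
      rw [this, Finset.sum_const, hJ, nsmul_eq_mul]; field_simp; ring
    · let exc : Fin B → Z → ℝ := fun b z => max (p b z - Real.exp ε * p x₀ z) 0
      have hexc : ∑ z, ∑ b ∈ J, exc b z ≤ D * δ := by
        rw [Finset.sum_comm]
        refine (Finset.sum_le_sum fun b _ => hR.sum_max_sub_le hδ0 b x₀).trans_eq ?_
        rw [Finset.sum_const, hJ, nsmul_eq_mul]
      have hz : ∀ z, (M z - ∑ b ∈ J, exc b z) / (8 * (D : ℝ) ^ 2) / 2 ≤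
          π x₀ * p x₀ z * (∑ b, π b * p b z - π x₀ * p x₀ z) / ∑ b, π b * p b z := by
        intro z
        rw [hsum, hπx₀, add_sub_cancel_left]
        have hE : 0 ≤ ∑ b ∈ J, exc b z := Finset.sum_nonneg fun b _ => le_max_right _ _
        obtain ⟨j, hj, hjM⟩ := Finset.exists_mem_eq_sup' hJne fun b => p b z
        have hjM : M z = p j z := hjM
        have hp0z := hp0 x₀ z
        refine div_two_le_mul_div_add (mul_nonneg (by linarith) hp0z)
          (Finset.sum_nonneg fun b _ => mul_nonneg (by positivity) (hp0 b z)) ?_ ?_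
        · have h1 : exc j z ≤ ∑ b ∈ J, exc b z :=
            Finset.single_le_sum (f := fun b => exc b z) (fun b _ => le_max_right _ _) hj
          have h2 : p j z - Real.exp ε * p x₀ z ≤ exc j z := le_max_left _ _
          have h3 : Real.exp ε * p x₀ z ≤ 4 * (D : ℝ) ^ 2 * p x₀ z := by gcongr
          calc (M z - ∑ b ∈ J, exc b z) / (8 * (D : ℝ) ^ 2)
              ≤ 4 * (D : ℝ) ^ 2 * p x₀ z / (8 * (D : ℝ) ^ 2) := by gcongr; linarith
            _ = 1 / 2 * p x₀ z := by field_simp; ring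
            _ ≤ _ := by gcongr; linarith
        · calc (M z - ∑ b ∈ J, exc b z) / (8 * (D : ℝ) ^ 2)
              ≤ M z / (8 * (D : ℝ) ^ 2) := by gcongr; linarith
            _ ≤ M z / (2 * (D : ℝ) ^ 2) := by
                have := hM0 z
                gcongr
                norm_num
            _ = 1 / (2 * (D : ℝ) ^ 2) * p j z := by rw [hjM]; ring
            _ ≤ _ := Finset.single_le_sum (f := fun b => 1 / (2 * (D : ℝ) ^ 2) * p b z)
                (fun b _ => mul_nonneg (by positivity) (hp0 b z)) hj
      refine le_trans ?_ (Finset.sum_le_sum fun z _ => hz z)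
      rw [← Finset.sum_div, ← Finset.sum_div, Finset.sum_sub_distrib, div_div,
        div_le_div_iff₀ (by positivity) (by positivity)]
      -- Here `∑ z, M z > D/2` and the excess is at most `Dδ ≤ D/4`, which yields `(D/4) / (16D²) =
      -- 1/(64D)`.
      have h1 : (D : ℝ) / 4 ≤ ∑ z, M z - ∑ z, ∑ b ∈ J, exc b z := by nlinarith
      nlinarith

/-! ### Group privacy and packing -/

theorem one_sub_sum_le_prod_one_sub {ι : Type*} (s : Finset ι) {r : ι → ℝ}
    (h0 : ∀ i ∈ s, 0 ≤ r i) (h1 : ∀ i ∈ s, r i ≤ 1) : 1 - ∑ i ∈ s, r i ≤ ∏ i ∈ s, (1 - r i) := by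
  classical
  induction s using Finset.induction_on with
  | empty => simp
  | insert a s ha ih =>
    rw [Finset.sum_insert ha, Finset.prod_insert ha]
    have h2 := ih (fun i hi => h0 i (Finset.mem_insert_of_mem hi))
      (fun i hi => h1 i (Finset.mem_insert_of_mem hi))
    have h3 := h0 a (Finset.mem_insert_self a s)
    have h4 := h1 a (Finset.mem_insert_self a s)
    have h5 : 0 ≤ ∑ i ∈ s, r i := Finset.sum_nonneg fun i hi => h0 i (Finset.mem_insert_of_mem hi)
    nlinarith

/-- Group privacy of the message vector of a locally private protocol. -/
theorem IsLocallyDP.group_privacy {n B : ℕ} {Z : Type*} [Fintype Z] {R : Fin B → PMF Z} {ε δ : ℝ}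
    (h : IsLocallyDP R ε δ) (hε : 0 ≤ ε) (hδ : 0 ≤ δ) {m : ℕ} (x y : Fin n → Fin B)
    (hm : (Finset.univ.filter fun i => x i ≠ y i).card ≤ m) (f : (Fin n → Z) → ℝ)
    (hf0 : ∀ z, 0 ≤ f z) (hf1 : ∀ z, f z ≤ 1) :
    ∑ z : Fin n → Z, (∏ i, (R (x i) (z i)).toReal) * f z
      ≤ Real.exp (m * ε) * ∑ z : Fin n → Z, (∏ i, (R (y i) (z i)).toReal) * f z + m * δ := by
  set p : Fin B → Z → ℝ := fun b z => (R b z).toReal with hp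
  have hp0 : ∀ b z, 0 ≤ p b z := fun b z => ENNReal.toReal_nonneg
  have hp1 : ∀ b, ∑ z, p b z = 1 := fun b => PMF.sum_toReal_eq_one _
  -- Trimming each changed coordinate to its purely private part loses mass at most `δ`; by the
  -- Bernoulli inequality the product loses at most `mδ`, with no exponential factor.
  let g : Fin n → Z → ℝ := fun i z =>
    if x i ≠ y i then min (p (x i) z) (Real.exp ε * p (y i) z) else p (x i) z
  have hg0 : ∀ i z, 0 ≤ g i z := fun i z => by
    have := hp0 (x i) z
    have := hp0 (y i) z
    simp only [g]; split_ifs <;> positivity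
  have hgp : ∀ i z, g i z ≤ p (x i) z := fun i z => by
    simp only [g]; split_ifs
    exacts [min_le_left _ _, le_rfl]
  have hgy : ∀ i z, g i z ≤ (if x i ≠ y i then Real.exp ε else 1) * p (y i) z := fun i z => by
    simp only [g]; split_ifs with hi
    · exact min_le_right _ _
    · rw [not_not.1 hi, one_mul]
  have hr : ∀ i, 1 - ∑ z, g i z ≤ if x i ≠ y i then δ else 0 := fun i => by
    rw [← hp1 (x i), ← Finset.sum_sub_distrib]
    simp only [g]; split_ifs
    · refine le_of_eq_of_le (Finset.sum_congr rfl fun z _ => ?_) (h.sum_max_sub_le hδ (x i) (y i))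
      rcases le_total (p (x i) z) (Real.exp ε * p (y i) z) with hle | hle
      · rw [min_eq_left hle, max_eq_right (sub_nonpos.2 hle), sub_self]
      · rw [min_eq_right hle, max_eq_left (sub_nonneg.2 hle)]
    · simp
  have hg1 : ∀ i, ∑ z, g i z ≤ 1 := fun i =>
    (Finset.sum_le_sum fun z _ => hgp i z).trans_eq (hp1 _)
  have hsum0 : ∀ i, 0 ≤ ∑ z, g i z := fun i => Finset.sum_nonneg fun z _ => hg0 i z
  have hmδ : 1 - ∏ i, ∑ z, g i z ≤ m * δ := by
    have h1 := one_sub_sum_le_prod_one_sub Finset.univ (r := fun i => 1 - ∑ z, g i z)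
      (fun i _ => sub_nonneg.2 (hg1 i)) (fun i _ => sub_le_self _ (hsum0 i))
    simp only [sub_sub_cancel] at h1
    have h2 : ∑ i, (1 - ∑ z, g i z) ≤ m * δ := by
      refine (Finset.sum_le_sum fun i _ => hr i).trans ?_
      rw [← Finset.sum_filter, Finset.sum_const, nsmul_eq_mul]
      gcongr
    linarith
  have hA : ∑ z : Fin n → Z, (∏ i, p (x i) (z i) - ∏ i, g i (z i)) * f z ≤ m * δ := by
    refine le_trans ?_ hmδ
    have : 1 - ∏ i, ∑ z, g i z = ∑ z : Fin n → Z, (∏ i, p (x i) (z i) - ∏ i, g i (z i)) := by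
      rw [Finset.sum_sub_distrib, sum_pi_prod g, sum_pi_prod fun i => p (x i)]
      simp [hp1]
    rw [this]
    refine Finset.sum_le_sum fun z _ => mul_le_of_le_one_right ?_ (hf1 z)
    exact sub_nonneg.2 (Finset.prod_le_prod (fun i _ => hg0 i _) fun i _ => hgp i _)
  have hB : ∑ z : Fin n → Z, (∏ i, g i (z i)) * f z
      ≤ Real.exp (m * ε) * ∑ z : Fin n → Z, (∏ i, p (y i) (z i)) * f z := by
    rw [Finset.mul_sum]
    refine Finset.sum_le_sum fun z _ => ?_
    rw [← mul_assoc]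
    refine mul_le_mul_of_nonneg_right ?_ (hf0 z)
    have hprod : 0 ≤ ∏ i, p (y i) (z i) := Finset.prod_nonneg fun i _ => hp0 _ _
    calc ∏ i, g i (z i) ≤ ∏ i, ((if x i ≠ y i then Real.exp ε else 1) * p (y i) (z i)) :=
          Finset.prod_le_prod (fun i _ => hg0 i _) fun i _ => hgy i _
      _ = Real.exp ε ^ (Finset.univ.filter fun i => x i ≠ y i).card * ∏ i, p (y i) (z i) := by
          rw [Finset.prod_mul_distrib, ← Finset.prod_filter, Finset.prod_const]
      _ ≤ Real.exp (m * ε) * ∏ i, p (y i) (z i) := by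
          rw [Real.exp_nat_mul]
          exact mul_le_mul_of_nonneg_right
            (pow_le_pow_right₀ (Real.one_le_exp hε) hm) hprod
  simp only [sub_mul, Finset.sum_sub_distrib] at hA
  linarith

/-- Packing bound: if `m` users cannot be hidden, the error is at least half their share. -/
theorem IsAccurate.div_le_of_isLocallyDP {n B : ℕ} {Z : Type*} [Fintype Z]
    {R : Fin B → PMF Z} {A : (Fin n → Z) → ProbabilityMeasure (Fin B → unitInterval)}
    {α ε δ : ℝ} (h : IsAccurate R A α (1 / 4)) (hR : IsLocallyDP R ε δ) (hε : 0 ≤ ε) (hδ : 0 ≤ δ)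
    (hB : 2 ≤ B) {m : ℕ} (hmn : m ≤ n) (hn : 0 < n) (hmε : Real.exp (m * ε) ≤ B)
    (hmδ : m * δ ≤ 1 / 8) :
    (m : ℝ) / (2 * n) ≤ α := by
  by_contra! hα
  have hn' : (0 : ℝ) < n := by exact_mod_cast hn
  have hB' : (2 : ℝ) ≤ B := by exact_mod_cast hB
  set x₀ : Fin B := ⟨0, by omega⟩
  let X : Fin B → Fin n → Fin B := fun j i => if (i : ℕ) < m then j else x₀
  have hcard : (Finset.univ.filter fun i : Fin n => (i : ℕ) < m).card = m := by
    rw [Fin.card_filter_val_lt, min_eq_right hmn]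
  have hdiff : ∀ j k, (Finset.univ.filter fun i => X j i ≠ X k i).card ≤ m := fun j k => by
    rw [← hcard]
    refine Finset.card_le_card fun i hi => ?_
    simp only [Finset.mem_filter, Finset.mem_univ, true_and, X] at hi ⊢
    by_contra hlt
    simp [hlt] at hi
  let S : Fin B → Set (Fin B → unitInterval) := fun k =>
    {y | ∀ j, |(y j : ℝ) - frequency (X k) j| ≤ α}
  have hSm : ∀ k, MeasurableSet (S k) := fun k => by
    have : S k = ⋂ j, {y | |(y j : ℝ) - frequency (X k) j| ≤ α} := by ext; simp [S]
    rw [this]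
    exact MeasurableSet.iInter fun j => (isClosed_le (by fun_prop) continuous_const).measurableSet
  have hgap : ∀ j k, j ≠ k → ∃ b, (m : ℝ) / n ≤ |frequency (X j) b - frequency (X k) b| := by
    -- The value `x₀` is excluded because it also fills the remaining `n - m` entries; of two
    -- distinct values at least one is not `x₀`.
    have key : ∀ j k, j ≠ k → j ≠ x₀ → (m : ℝ) / n ≤ |frequency (X j) j - frequency (X k) j| := by
      intro j k hjk hj
      have h1 : (Finset.univ.filter fun i => X j i = j)
          = Finset.univ.filter fun i : Fin n => (i : ℕ) < m := by
        ext i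
        simp only [X, Finset.mem_filter, Finset.mem_univ, true_and]
        split_ifs with hi <;> simp [hi, hj.symm]
      have h2 : (Finset.univ.filter fun i => X k i = j) = ∅ := by
        ext i
        simp only [X, Finset.mem_filter, Finset.mem_univ, true_and]
        split_ifs with hi <;> simp [hjk.symm, hj.symm]
      simp only [frequency, h1, h2, hcard]
      simpa using le_abs_self ((m : ℝ) / n)
    intro j k hjk
    by_cases hj : j = x₀
    · refine ⟨k, ?_⟩
      rw [abs_sub_comm]
      exact key k j hjk.symm fun hk => hjk (hj.trans hk.symm)
    · exact ⟨j, key j k hjk hj⟩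
  have hSd : Pairwise (Function.onFun Disjoint S) := by
    intro j k hjk
    refine Set.disjoint_left.2 fun y hy1 hy2 => ?_
    obtain ⟨b, hb⟩ := hgap j k hjk
    have h1 := abs_le.1 (hy1 b)
    have h2 := abs_le.1 (hy2 b)
    have h3 : |frequency (X j) b - frequency (X k) b| ≤ 2 * α := abs_le.2 ⟨by linarith, by linarith⟩
    have h4 : (m : ℝ) / n = 2 * (m / (2 * n)) := by field_simp
    linarith
  let T : Fin B → ℝ := fun k =>
    ∑ z : Fin n → Z, (∏ i, (R (X x₀ i) (z i)).toReal) * (A z : Measure _).real (S k)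
  have hT : ∑ k, T k ≤ 1 := by
    simp only [T]
    rw [Finset.sum_comm]
    simp only [← Finset.mul_sum]
    calc _ ≤ ∑ z : Fin n → Z, (∏ i, (R (X x₀ i) (z i)).toReal) * 1 := by
          refine Finset.sum_le_sum fun z _ => mul_le_mul_of_nonneg_left ?_
            (Finset.prod_nonneg fun i _ => ENNReal.toReal_nonneg)
          refine sum_measureReal_le_of_card_le _ hSm _ fun y t _ ht => ?_
          have : t.card ≤ 1 := Finset.card_le_one.2 fun a ha b hb => by
            by_contra hab
            exact Set.disjoint_left.1 (hSd hab) (ht a ha) (ht b hb)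
          exact_mod_cast this
      _ = 1 := by
          simp only [mul_one]
          rw [sum_pi_prod fun i z => (R (X x₀ i) z).toReal]
          simp [PMF.sum_toReal_eq_one]
  have hT0 : 3 / 4 ≤ T x₀ := by
    have := h.le_real (X x₀) (S := S x₀) subset_rfl
    linarith
  -- `3/4 - 1/8 = 5/8`. Summed over `k` this alone is compatible with total mass `1`; the mass `3/4`
  -- at `x₀` gives the contradiction once `B ≥ 2`.
  have hTk : ∀ k, 5 / 8 ≤ B * T k := fun k => by
    have h1 := h.le_real (X k) (S := S k) subset_rfl
    have h2 := hR.group_privacy hε hδ (X k) (X x₀) (hdiff k x₀)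
      (fun z => (A z : Measure _).real (S k)) (fun z => measureReal_nonneg)
      (fun z => measureReal_le_one)
    have h3 : 0 ≤ T k := Finset.sum_nonneg fun z _ => mul_nonneg
      (Finset.prod_nonneg fun i _ => ENNReal.toReal_nonneg) measureReal_nonneg
    have h4 := mul_le_mul_of_nonneg_right hmε h3
    simp only [T] at h4 ⊢
    linarith
  have hsplit : ∑ k, B * T k = B * T x₀ + ∑ k ∈ Finset.univ.erase x₀, B * T k :=
    (Finset.add_sum_erase _ _ (Finset.mem_univ x₀)).symm
  have hrest : ((B : ℝ) - 1) * (5 / 8) ≤ ∑ k ∈ Finset.univ.erase x₀, B * T k := by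
    refine le_trans (le_of_eq ?_) (Finset.sum_le_sum fun k _ => hTk k)
    rw [Finset.sum_const, Finset.card_erase_of_mem (Finset.mem_univ _), Finset.card_univ,
      Fintype.card_fin, nsmul_eq_mul, Nat.cast_sub (by omega), Nat.cast_one]
  rw [← Finset.mul_sum] at hsplit
  nlinarith

/-- The packing bound with the largest `m` such that `e^{mε} ≤ B`. As `ln B / ε ≥ 1`, the floor
costs at most a factor `2`. -/
theorem log_div_le_of_isAccurate {n B : ℕ} {Z : Type*} [Fintype Z]
    {R : Fin B → PMF Z} {A : (Fin n → Z) → ProbabilityMeasure (Fin B → unitInterval)}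
    {α ε δ : ℝ} (h : IsAccurate R A α (1 / 4)) (hR : IsLocallyDP R ε δ) (hε : 0 < ε) (hδ : 0 ≤ δ)
    (hnδ : n * δ ≤ 1 / 8) (hB : 2 ≤ B) (hn : Real.log B / ε ≤ n) (hεB : ε ≤ Real.log B) :
    1 / 4 * (Real.log B / (n * ε)) ≤ α := by
  have hB' : (2 : ℝ) ≤ B := by exact_mod_cast hB
  have hq : 1 ≤ Real.log B / ε := (one_le_div hε).2 hεB
  have hn0 : (0 : ℝ) < n := by linarith
  have hmle : (⌊Real.log B / ε⌋₊ : ℝ) ≤ Real.log B / ε := Nat.floor_le (by linarith)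
  have hmge : Real.log B / ε ≤ 2 * ⌊Real.log B / ε⌋₊ := by
    have h1 := Nat.lt_floor_add_one (Real.log B / ε)
    have h2 : (1 : ℝ) ≤ ⌊Real.log B / ε⌋₊ := by exact_mod_cast Nat.le_floor (by simpa using hq)
    linarith
  have hmn : (⌊Real.log B / ε⌋₊ : ℝ) ≤ n := hmle.trans hn
  refine le_trans ?_ (h.div_le_of_isLocallyDP hR hε.le hδ hB (m := ⌊Real.log B / ε⌋₊)
    (by exact_mod_cast hmn) (by exact_mod_cast hn0) ?_ ?_)
  · rw [le_div_iff₀ (by positivity)]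
    have : 1 / 4 * (Real.log B / (n * ε)) * (2 * n) = 1 / 2 * (Real.log B / ε) := by
      field_simp; ring
    linarith
  · rw [← Real.le_log_iff_exp_le (by linarith)]
    exact (le_div_iff₀ hε).1 hmle
  · exact (mul_le_mul_of_nonneg_right hmn hδ).trans hnδ

/-! ### Block sizes for the regimes -/

theorem mul_sqrt_div_le_one_div {b x : ℝ} (hb : 1 ≤ b) (hx : b ^ 2 ≤ x) :
    1 / 64 * (Real.sqrt b / x) ≤ 1 / (32 * Real.sqrt (x * b)) := by
  have hx0 : 0 < x := by nlinarith
  have hb0 : 0 < b := by linarith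
  have hs : Real.sqrt b * Real.sqrt (x * b) ≤ x := by
    rw [← Real.sqrt_mul hb0.le, Real.sqrt_le_left hx0.le]
    nlinarith
  rw [div_mul_div_comm, one_mul, div_le_div_iff₀ (by positivity) (by positivity)]
  linarith

theorem mul_div_le_one_div {b x : ℝ} (hb : 1 ≤ b) (hx : b ^ 3 ≤ x) :
    1 / 64 * (b / x) ≤ 1 / (32 * Real.sqrt (x * b)) := by
  have hx0 : 0 < x := (by positivity : 0 < b ^ 3).trans_le hx
  have hb0 : 0 < b := by linarith
  have hs : b * Real.sqrt (x * b) ≤ x := by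
    rw [← le_div_iff₀' hb0, Real.sqrt_le_left (by positivity), div_pow, le_div_iff₀ (by positivity)]
    nlinarith
  rw [div_mul_div_comm, one_mul, div_le_div_iff₀ (by positivity) (by positivity)]
  linarith

theorem theorem3p4 :
    ∃ c : ℝ, 0 < c ∧ ∃ C : ℝ, 0 < C ∧ ∃ k : ℕ,
      ∀ (n B : ℕ) (ε δ α : ℝ), 1 ≤ B → 1 / c ≤ (n : ℝ) → 0 < ε → 0 < δ →
        δ < c * min (1 / ((n : ℝ) * Real.logb 2 n)) (Real.exp (-ε)) →
        ∀ (Z : Type*) [Fintype Z] (R : Fin B → PMF Z)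
          (A : (Fin n → Z) → ProbabilityMeasure (Fin B → unitInterval)),
          IsLocallyDP R ε δ → IsAccurate R A α (1 / 4) →
          -- small-sample regime
          (Real.log B / (c * ε) ≤ n → ε ≤ Real.log B →
            C * (Real.log B / (n * ε)) ≤ α) ∧
          -- intermediate-sample regime, larger `ε`
          (Real.log B * Real.exp (ε / 2) ≤ n →
            2 / 3 * Real.log n ≤ ε + Real.log (1 + ε) + 1 / c →
            ε + Real.log (1 + ε) + 1 / c ≤ 2 * Real.log B →
            C * (1 / (Real.sqrt n * Real.exp (ε / 4))) / polylog k n B ≤ α) ∧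
          -- intermediate-sample regime, smaller `ε`
          (Real.log B ^ (3 / 2 : ℝ) ≤ n → (n : ℝ) ≤ (B : ℝ) ^ 3 → ε ≤ 2 / 3 * Real.log n →
            C * (1 / (n : ℝ) ^ (2 / 3 : ℝ)) / polylog k n B ≤ α) ∧
          -- large-sample regime, `n ≥ B ^ 2`
          ((B : ℝ) ^ 2 ≤ n → ε ≤ 2 * Real.log B →
            C * (Real.sqrt B / n) / polylog k n B ≤ α) ∧
          -- large-sample regime, `n ≥ B ^ 3`
          ((B : ℝ) ^ 3 ≤ n → ε ≤ 2 * Real.log B →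
            C * ((B : ℝ) / n) / polylog k n B ≤ α) := by
  -- `65536 = 256²`. With `k = 0` the bounds are proved without any logarithmic loss.
  refine ⟨1 / 65536, by norm_num, 1 / 64, by norm_num, 0, ?_⟩
  intro n B ε δ α hB hn hε hδ0 hδ Z _ R A hR hA
  rw [one_div_one_div] at hn ⊢
  simp only [polylog, pow_zero, div_one]
  have hn2 : 65536 ≤ n := by exact_mod_cast hn
  have hn0 : (0 : ℝ) < n := by linarith
  have hB1 : (1 : ℝ) ≤ B := by exact_mod_cast hB
  have hlogb : 1 ≤ Real.logb 2 n := by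
    rw [Real.le_logb_iff_rpow_le (by norm_num) hn0, Real.rpow_one]; linarith
  have hnδ : n * δ ≤ 1 / 8 := by
    have h1 : δ ≤ 1 / 65536 * (1 / (n * Real.logb 2 n)) :=
      hδ.le.trans (by gcongr; exact min_le_left _ _)
    have h2 : 1 / ((n : ℝ) * Real.logb 2 n) ≤ 1 / n := by
      gcongr
      exact le_mul_of_one_le_right hn0.le hlogb
    have h3 : n * (1 / (n : ℝ)) = 1 := by field_simp
    nlinarith
  have hδ4 : δ ≤ 1 / 4 := by nlinarith
  have hsplit : ∀ D : ℕ, Real.sqrt (n * D) = Real.sqrt n * Real.sqrt D := fun D =>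
    Real.sqrt_mul hn0.le _
  -- The block is everything but the reference, `D = B - 1`, and `B² ≤ 4(B - 1)²` since `B ≥ 2`.
  have hlarge : (B : ℝ) ^ 2 ≤ n → ε ≤ 2 * Real.log B →
      1 / (32 * Real.sqrt (n * B)) ≤ α := by
    intro hBn hεB
    have hB2 : 2 ≤ B := by
      by_contra hlt
      have : B = 1 := by omega
      subst this
      simp at hεB
      linarith
    have hB2' : (2 : ℝ) ≤ B := by exact_mod_cast hB2
    have hcast : ((B - 1 : ℕ) : ℝ) = B - 1 := by rw [Nat.cast_sub hB, Nat.cast_one]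
    have hDn : 256 * (B - 1) ≤ n := by
      -- From `n ≥ B²` if `B ≥ 256`, and from `n ≥ 256²` otherwise.
      have : (256 : ℝ) * B ≤ n := by
        by_contra! hlt
        nlinarith
      have : 256 * B ≤ n := by exact_mod_cast this
      omega
    have hexp : Real.exp ε ≤ 4 * ((B - 1 : ℕ) : ℝ) ^ 2 := by
      rw [hcast]
      calc Real.exp ε ≤ Real.exp (2 * Real.log B) := Real.exp_le_exp.2 hεB
        _ = (B : ℝ) ^ 2 := by
          rw [mul_comm, Real.exp_mul, Real.exp_log (by linarith)]; norm_cast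
        _ ≤ _ := by nlinarith
    refine le_trans ?_ (hA.one_div_sqrt_le_of_isLocallyDP hR (D := B - 1) (by omega) (by omega)
      hDn hexp hδ0.le hδ4)
    have : (0 : ℝ) < n * ((B - 1 : ℕ) : ℝ) := by rw [hcast]; nlinarith
    gcongr
    exact Nat.sub_le _ _
  refine ⟨?_, ?_, ?_, ?_, ?_⟩
  · intro h1 h2
    have hB2 : 2 ≤ B := by
      by_contra hlt
      have : B = 1 := by omega
      subst this
      simp at h2
      linarith
    have hL : 0 < Real.log B := hε.trans_le h2
    have hn' : Real.log B / ε ≤ n := by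
      refine le_trans ?_ h1
      gcongr
      linarith
    refine le_trans ?_ (log_div_le_of_isAccurate hA hR hε hδ0.le hnδ hB2 hn' h2)
    gcongr
    norm_num
  · intro h1 _ h3
    have he1 : 1 ≤ Real.exp (ε / 2) := Real.one_le_exp (by linarith)
    have hlog1 : 0 ≤ Real.log (1 + ε) := Real.log_nonneg (by linarith)
    -- Essentially the smallest block that `e^ε ≤ 4D²` permits. The term `1/c` in the upper bound on
    -- `ε` leaves room for `D + 1 ≤ 3e^{ε/2} ≤ B`.
    set D := ⌈Real.exp (ε / 2)⌉₊ with hD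
    have hDge : Real.exp (ε / 2) ≤ D := Nat.le_ceil _
    have hDlt : (D : ℝ) < Real.exp (ε / 2) + 1 := Nat.ceil_lt_add_one (by linarith)
    have hDB : D + 1 ≤ B := by
      have h4 : Real.exp (ε / 2) * 3 ≤ B := by
        calc Real.exp (ε / 2) * 3 ≤ Real.exp (ε / 2) * Real.exp 2 := by
              gcongr; linarith [Real.add_one_le_exp (2 : ℝ)]
          _ = Real.exp (ε / 2 + 2) := (Real.exp_add _ _).symm
          _ ≤ Real.exp (Real.log B) := Real.exp_le_exp.2 (by linarith)
          _ = B := Real.exp_log (by linarith)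
      have : (D : ℝ) + 1 ≤ B := by linarith
      exact_mod_cast this
    have hDn : 256 * D ≤ n := by
      have : (256 : ℝ) * D ≤ n := by nlinarith
      exact_mod_cast this
    have hexp : Real.exp ε = Real.exp (ε / 2) ^ 2 := by
      rw [← Real.exp_nat_mul]; congr 1; push_cast; ring
    have hexp4 : Real.exp (ε / 2) = Real.exp (ε / 4) ^ 2 := by
      rw [← Real.exp_nat_mul]; congr 1; push_cast; ring
    have hD1 : 1 ≤ D := by
      have : (1 : ℝ) ≤ D := he1.trans hDge
      exact_mod_cast this
    have hD0 : (0 : ℝ) < D := by exact_mod_cast hD1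
    refine le_trans ?_ (hA.one_div_sqrt_le_of_isLocallyDP hR hD1 hDB hDn ?_ hδ0.le hδ4)
    · have hs : Real.sqrt D ≤ 2 * Real.exp (ε / 4) := by
        rw [Real.sqrt_le_left (by positivity), mul_pow, ← hexp4]; linarith
      rw [hsplit, one_div_mul_one_div]
      refine one_div_le_one_div_of_le (by positivity) ?_
      nlinarith [mul_le_mul_of_nonneg_left hs (Real.sqrt_nonneg n)]
    · rw [hexp]; nlinarith
  · intro _ h2 h3
    set r : ℝ := (n : ℝ) ^ (1 / 3 : ℝ) with hr
    have hr0 : 0 < r := Real.rpow_pos_of_pos hn0 _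
    have hr3 : r ^ 3 = n := by
      rw [hr, ← Real.rpow_natCast, ← Real.rpow_mul hn0.le]; norm_num
    have hr2 : r ^ 2 = (n : ℝ) ^ (2 / 3 : ℝ) := by
      rw [hr, ← Real.rpow_natCast, ← Real.rpow_mul hn0.le]; norm_num
    have hr32 : 32 ≤ r := by
      by_contra! hlt
      have : r ^ 3 < 32 ^ 3 := by gcongr
      rw [hr3] at this
      norm_num at this
      linarith
    have hrB : r ≤ B := by
      rw [← hr3] at h2
      exact le_of_pow_le_pow_left₀ (by norm_num) (by linarith) h2
    have hc1 : 1 ≤ ⌈r⌉₊ := Nat.one_le_ceil_iff.2 hr0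
    have hcast : ((⌈r⌉₊ - 1 : ℕ) : ℝ) = ⌈r⌉₊ - 1 := by rw [Nat.cast_sub hc1, Nat.cast_one]
    have hlt := Nat.ceil_lt_add_one hr0.le
    have hge := Nat.le_ceil r
    have hDB : ⌈r⌉₊ - 1 + 1 ≤ B := by
      rw [Nat.sub_add_cancel hc1]; exact Nat.ceil_le.2 hrB
    -- The ceiling minus one, rather than the floor, leaves a reference value even when `r = B`; `D
    -- ≥ r - 1 ≥ r/2` still gives `e^ε ≤ r² ≤ 4D²`.
    set D := ⌈r⌉₊ - 1 with hD
    have hDr : (D : ℝ) ≤ r := by linarith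
    have hD1 : (1 : ℝ) ≤ D := by linarith
    have hDn : 256 * D ≤ n := by
      have : (256 : ℝ) * D ≤ n := by nlinarith
      exact_mod_cast this
    refine le_trans ?_ (hA.one_div_sqrt_le_of_isLocallyDP hR (by exact_mod_cast hD1) hDB hDn ?_
      hδ0.le hδ4)
    · have hs : Real.sqrt (n * D) ≤ r ^ 2 := by
        rw [Real.sqrt_le_left (by positivity), ← hr3]
        nlinarith [pow_pos hr0 3]
      rw [← hr2, one_div_mul_one_div]
      refine one_div_le_one_div_of_le (by positivity) ?_
      nlinarith [sq_nonneg r]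
    · calc Real.exp ε ≤ Real.exp (Real.log n * (2 / 3)) := Real.exp_le_exp.2 (by linarith)
        _ = r ^ 2 := by rw [hr2, Real.rpow_def_of_pos hn0]
        _ ≤ _ := by nlinarith
  · intro h1 h2
    refine le_trans ?_ (hlarge h1 h2)
    exact mul_sqrt_div_le_one_div hB1 h1
  · intro h1 h2
    have h1' : (B : ℝ) ^ 2 ≤ n := (pow_le_pow_right₀ hB1 (by norm_num)).trans h1
    refine le_trans ?_ (hlarge h1' h2)
    exact mul_div_le_one_div hB1 h1
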